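/- Let $S$ be a connected oriented punctured surface with a finite connected graph $G\subset S$ as spine (so $G$ inherits a cyclic order of edge ends at each vertex), and let $f:G\to G$ be a train track map: it maps vertices to vertices and edges to edge paths, and no $f^r(e)$ ($r\ge 1$, $e$ an edge) backtracks. Two edge ends at a vertex $v$ lie in the same gate if for some $r>0$ their images under $f^r$ have a nontrivial common initial segment. Two different gates at $v$ are joined by an infinitesimal edge if some $f^r(e)$, $r>0$, passes through $v$ from an edge end in one of them to an edge end in the other. The train track $\tau\subset S$ has the gates as switches and as branches the real edges (edges of $G$) and the infinitesimal edges; at each switch the real branches lie on one side and the infinitesimal branches on the other. Assume, as holds for the train tracks that the Bestvina–Handel construction associates with pseudo-Anosov maps of $S$, that at every vertex $v$ with $k$ gates the infinitesimal edges are, in the cyclic order at $v$, either the sides of a complete $k$-gon ($k\ge 3$; $v$ is called odd or even according to the parity of $k$) or those of a $k$-gon with one side missing ($v$ is called partial). $\tau$ is orientable if its branches can be oriented so that every smooth passage through a switch is from an incoming to an outgoing branch and any two branches on the same side of a switch are both incoming or both outgoing. Let $W(\tau)$ be the space of real (possibly negative) weights on the branches of $\tau$ such that at each switch the total weights on the two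 sides agree, and let $W(G,f)=\pi_*(W(\tau))$ be the space of weights on the edges of $G$ obtained by restricting elements of $W(\tau)$ to the real edges ($\pi:\tau\to G$ collapses the infinitesimal polygons). Let $S'$ be $S$ with a puncture added inside each complete infinitesimal polygon, so that $S'$ deformation retracts to $\tau$. The orientation cover $p:\tilde S\to S$ is obtained from the double cover of $S'$ in which a loop of $\tau$ lifts to a closed loop if and only if it has an even number of corners (passages between two branches on the same side of a switch), by filling in the punctures lying over the added ones. Let $\iota$ be its deck involution and $\tilde\tau=p^{-1}(\tau)$, with its canonical orientation, which $\iota$ reverses. **Theorem.** Suppose $\tau$ is non-orientable. Let $E^{\pm}$ be the eigenspaces of $\iota_*$ on $H_1(\tilde S;\mathbb R)$ for the eigenvalues $\pm1$. Then: 1. $H_1(\tilde S;\mathbb R)=E^+\oplus E^-$. 2. $E^+\cong H_1(S;\mathbb R)$; an isomorphism $H_1(S;\mathbb R)\to E^+$ sends the class of a 1-cycle $c$ of $\tau$ to the class of its full preimage in $\tilde\tau$ (both lifts of each branch, with the coefficient of that branch). 3. $E^-\cong W(G,f)$; an isomorphism $W(G,f)\to E^-$ is given by lifting weights to both preimages of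 an edge: for every $\mu\in W(\tau)$ it sends $\eta=\pi_*\mu$ to the class of the cycle $\sum_b \mu(b)(\tilde b+\tilde b')$, where $b$ runs over the branches of $\tau$ and $\tilde b,\tilde b'$ are its two preimages, oriented by the orientation of $\tilde\tau$. In particular, the real edges contribute $\sum_e \eta(e)(\tilde e+\tilde e')$, where $e$ runs over the edges of $G$. -/

import Mathlib

open scoped Classical in
/-- The elementary alternating 1-chain carried by the oriented edge `a` with reverse `ra`. -/
noncomputable def arcChain {A : Type*} (a ra : A) : A → ℝ :=
  fun b => (if b = a then 1 else 0) - (if b = ra then 1 else 0)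

/-! ### Two-dimensional cell complexes and their first homology -/

/-- A two-dimensional cell complex with finitely many edges. `Arc` is the set of *oriented* edges,
`rev` reverses the orientation. The 2-cell `F` is a disc attached along the closed edge path
`side F 0, side F 1, …, side F (len F - 1)`, indexed periodically by `ℕ`. -/
structure CellComplex.{u} where
  Vert : Type u
  Arc : Type u
  Face : Type u
  fintypeArc : Fintype Arc
  src : Arc → Vert
  rev : Arc → Arc
  rev_rev : ∀ a, rev (rev a) = a
  rev_ne : ∀ a, rev a ≠ a
  len : Face → ℕ
  side : Face → ℕ → Arc
  side_periodic : ∀ F i, side F (i + len F) = side F i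
  side_next : ∀ F i, src (rev (side F i)) = src (side F (i + 1))

namespace CellComplex

attribute [instance] CellComplex.fintypeArc

variable (X : CellComplex)

open scoped Classical in
/-- The boundary `∂₁`. A 1-chain is a function `c` on oriented edges with `c (rev a) = - c a`; the
coefficient of `∂₁ c` at `v` is the sum of `c a` over the oriented edges `a` that end at `v`
(each edge is counted once with each orientation, hence once at its end with coefficient `c a`
and once at its origin with coefficient `- c a`). -/
noncomputable def boundaryOne : (X.Arc → ℝ) →ₗ[ℝ] (X.Vert → ℝ) where
  toFun c v := ∑ a, if X.src (X.rev a) = v then c a else 0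
  map_add' c d := by
    funext v
    simp only [Pi.add_apply, ← Finset.sum_add_distrib]
    exact Finset.sum_congr rfl fun a _ => by split_ifs <;> simp
  map_smul' r c := by
    funext v
    simp only [Pi.smul_apply, smul_eq_mul, RingHom.id_apply, Finset.mul_sum]
    exact Finset.sum_congr rfl fun a _ => by split_ifs <;> simp

/-- The space `C₁` of real cellular 1-chains. -/
def chains : Submodule ℝ (X.Arc → ℝ) where
  carrier := {c | ∀ a, c (X.rev a) = - c a}
  zero_mem' a := by simp
  add_mem' {c d} hc hd a := by simp only [Pi.add_apply, hc a, hd a]; ring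
  smul_mem' r c hc a := by simp only [Pi.smul_apply, hc a, smul_neg]

/-- The space `Z₁` of real cellular 1-cycles. -/
noncomputable def cycles : Submodule ℝ (X.Arc → ℝ) :=
  X.chains ⊓ LinearMap.ker X.boundaryOne

/-- The boundary `∂₂ F` of a 2-cell. -/
noncomputable def faceBoundary (F : X.Face) : X.Arc → ℝ :=
  ∑ i ∈ Finset.range (X.len F), arcChain (X.side F i) (X.rev (X.side F i))

/-- The space `B₁`, the image of `∂₂`. -/
noncomputable def boundaries : Submodule ℝ (X.Arc → ℝ) :=
  Submodule.span ℝ (Set.range X.faceBoundary)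

/-- The first cellular homology `H₁(X; ℝ) = Z₁ / B₁`. -/
abbrev H1 : Type _ := X.cycles ⧸ X.boundaries.submoduleOf X.cycles

/-- The homology class of a cycle. -/
noncomputable def homologyClass : X.cycles →ₗ[ℝ] X.H1 :=
  (X.boundaries.submoduleOf X.cycles).mkQ

theorem arcChain_mem_chains (a : X.Arc) : arcChain a (X.rev a) ∈ X.chains := by
  intro b
  have h1 : (X.rev b = a) ↔ (b = X.rev a) :=
    ⟨fun h => by rw [← h, X.rev_rev], fun h => by rw [h, X.rev_rev]⟩
  have h2 : (X.rev b = X.rev a) ↔ (b = a) :=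
    ⟨fun h => by rw [← X.rev_rev b, h, X.rev_rev], fun h => by rw [h]⟩
  classical
  simp only [arcChain]
  rw [if_congr h1 rfl rfl, if_congr h2 rfl rfl]
  ring

open scoped Classical in
theorem boundaryOne_arcChain (a : X.Arc) (v : X.Vert) :
    X.boundaryOne (arcChain a (X.rev a)) v =
      (if X.src (X.rev a) = v then 1 else 0) - (if X.src a = v then 1 else 0) := by
  have key : ∀ b : X.Arc,
      (if X.src (X.rev b) = v then arcChain a (X.rev a) b else 0) =
        (if b = a then (if X.src (X.rev a) = v then 1 else 0) else 0) -
          (if b = X.rev a then (if X.src a = v then 1 else 0) else (0 : ℝ)) := by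
    intro b
    by_cases hb : b = a
    · subst hb
      simp [arcChain, (X.rev_ne b).symm]
    · by_cases hb' : b = X.rev a
      · subst hb'
        simp [arcChain, X.rev_ne, X.rev_rev]
        split_ifs <;> simp
      · simp [arcChain, hb, hb']
  simp only [boundaryOne, LinearMap.coe_mk, AddHom.coe_mk, key, Finset.sum_sub_distrib,
    Finset.sum_ite_eq', Finset.mem_univ, if_true]

/-- `∂₁ ∂₂ = 0`. -/
theorem boundaries_le_cycles : X.boundaries ≤ X.cycles := by
  refine Submodule.span_le.2 ?_
  rintro _ ⟨F, rfl⟩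
  refine ⟨Submodule.sum_mem _ fun i _ => X.arcChain_mem_chains _, ?_⟩
  refine LinearMap.mem_ker.2 (funext fun v => ?_)
  classical
  simp only [faceBoundary, map_sum, Finset.sum_apply, boundaryOne_arcChain, X.side_next]
  rw [Finset.sum_range_sub (fun i => if X.src (X.side F i) = v then (1 : ℝ) else 0)]
  have h := X.side_periodic F 0
  rw [zero_add] at h
  simp [h]

/-- A cellular homeomorphism of `X`, given by its action on the cells. The characteristic map of
a 2-cell may be rotated. -/
structure Symmetry where
  vert : X.Vert ≃ X.Vert
  arc : X.Arc ≃ X.Arc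
  face : X.Face ≃ X.Face
  src_arc : ∀ a, X.src (arc a) = vert (X.src a)
  rev_arc : ∀ a, X.rev (arc a) = arc (X.rev a)
  len_face : ∀ F, X.len (face F) = X.len F
  side_face : ∀ F, ∃ r, ∀ i, X.side (face F) i = arc (X.side F (i + r))

namespace Symmetry

variable {X} (φ : X.Symmetry)

/-- The chain map induced on 1-chains: the coefficient of `arc a` in the image of `c` is `c a`. -/
def onChains : (X.Arc → ℝ) →ₗ[ℝ] (X.Arc → ℝ) :=
  LinearMap.funLeft ℝ ℝ φ.arc.symm

theorem rev_arc_symm (a : X.Arc) : X.rev (φ.arc.symm a) = φ.arc.symm (X.rev a) := by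
  apply φ.arc.injective
  rw [← φ.rev_arc]
  simp

theorem onChains_arcChain (a : X.Arc) :
    φ.onChains (arcChain a (X.rev a)) = arcChain (φ.arc a) (X.rev (φ.arc a)) := by
  classical
  funext b
  simp only [onChains, LinearMap.funLeft_apply, arcChain]
  rw [if_congr (Equiv.symm_apply_eq φ.arc) rfl rfl,
    if_congr (Equiv.symm_apply_eq φ.arc) rfl rfl, φ.rev_arc]

theorem onChains_mem_cycles (c : X.Arc → ℝ) (hc : c ∈ X.cycles) :
    φ.onChains c ∈ X.cycles := by
  classical
  obtain ⟨h1, h2⟩ := hc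
  refine ⟨fun a => ?_, LinearMap.mem_ker.2 (funext fun v => ?_)⟩
  · simp only [onChains, LinearMap.funLeft_apply, ← φ.rev_arc_symm]
    exact h1 _
  · have h3 := congrFun (LinearMap.mem_ker.1 h2) (φ.vert.symm v)
    simp only [boundaryOne, LinearMap.coe_mk, AddHom.coe_mk, Pi.zero_apply, onChains,
      LinearMap.funLeft_apply] at h3 ⊢
    refine Eq.trans ?_ h3
    rw [← Equiv.sum_comp φ.arc]
    refine Finset.sum_congr rfl fun a _ => ?_
    rw [φ.rev_arc, φ.src_arc, Equiv.symm_apply_apply]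
    exact if_congr (Equiv.eq_symm_apply φ.vert).symm rfl rfl

theorem sum_range_shift {M : Type*} [AddCommGroup M] (h : ℕ → M) (n : ℕ)
    (hp : ∀ i, h (i + n) = h i) (r : ℕ) :
    ∑ i ∈ Finset.range n, h (i + r) = ∑ i ∈ Finset.range n, h i := by
  induction r with
  | zero => simp
  | succ r ih =>
    rw [← ih]
    have h1 := Finset.sum_range_succ (fun i => h (i + r)) n
    have h2 := Finset.sum_range_succ' (fun i => h (i + r)) n
    have h3 : h (n + r) = h (0 + r) := by rw [zero_add, add_comm, hp]
    rw [h1, h3] at h2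
    have h4 := add_right_cancel h2
    rw [h4]
    exact Finset.sum_congr rfl fun i _ => by congr 1; ring

theorem onChains_mem_boundaries (c : X.Arc → ℝ) (hc : c ∈ X.boundaries) :
    φ.onChains c ∈ X.boundaries := by
  have : X.boundaries ≤ X.boundaries.comap φ.onChains := by
    refine Submodule.span_le.2 ?_
    rintro _ ⟨F, rfl⟩
    refine Submodule.subset_span ⟨φ.face F, ?_⟩
    obtain ⟨r, hr⟩ := φ.side_face F
    simp only [faceBoundary, map_sum, onChains_arcChain, φ.len_face, hr]
    refine sum_range_shift
      (fun i => arcChain (φ.arc (X.side F i)) (X.rev (φ.arc (X.side F i)))) _ (fun i => ?_) r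
    simp only [X.side_periodic]
  exact this hc

/-- The induced map on `Z₁`. -/
noncomputable def onCycles : X.cycles →ₗ[ℝ] X.cycles :=
  φ.onChains.restrict φ.onChains_mem_cycles

/-- The induced map on `H₁(X; ℝ)`. -/
noncomputable def onH1 : X.H1 →ₗ[ℝ] X.H1 :=
  Submodule.mapQ _ _ φ.onCycles fun c hc => φ.onChains_mem_boundaries c.1 hc

end Symmetry

end CellComplex

/-! ### Graphs in surfaces and train track maps -/

/-- A finite connected graph `G` embedded in an oriented surface as a spine: `D` is the set of
oriented edges (darts), `rev` reverses a dart, and `next` sends a dart to the next dart, in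
counterclockwise order, with the same initial vertex. The surface `S` is the open regular
neighbourhood of `G`; its punctures correspond to the boundary cycles of the neighbourhood. -/
structure RibbonGraph (D : Type*) where
  rev : D → D
  rev_rev : ∀ d, rev (rev d) = d
  rev_ne : ∀ d, rev d ≠ d
  next : Equiv.Perm D
  connected : ∀ d e, Relation.ReflTransGen (fun a b => b = rev a ∨ b = next a) d e

namespace RibbonGraph

variable {D : Type*} (G : RibbonGraph D)

/-- The vertices: the cycles of `next`. -/
def Vertex : Type _ := Quotient (Equiv.Perm.SameCycle.setoid G.next)

/-- The initial vertex of a dart. -/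
def vertexOf (d : D) : G.Vertex := Quotient.mk _ d

/-- `V(G)`: real weights on the (unoriented) edges of `G`. -/
def V : Submodule ℝ (D → ℝ) where
  carrier := {η | ∀ d, η (G.rev d) = η d}
  zero_mem' d := by simp
  add_mem' {η ζ} hη hζ d := by simp only [Pi.add_apply, hη d, hζ d]
  smul_mem' r η hη d := by simp only [Pi.smul_apply, hη d]

end RibbonGraph

/-- A train track map `f : G → G`. Vertices are mapped to vertices, the dart `d` is mapped to the
edge path `path d`, and no iterate of `f` backtracks on an edge. -/
structure TrainTrackMap {D : Type*} (G : RibbonGraph D) where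
  path : D → List D
  path_ne_nil : ∀ d, path d ≠ []
  path_isChain : ∀ d, (path d).IsChain fun a b => G.vertexOf (G.rev a) = G.vertexOf b
  path_rev : ∀ d, path (G.rev d) = ((path d).map G.rev).reverse
  vertex_compat : ∀ d e, G.vertexOf d = G.vertexOf e →
    G.vertexOf ((path d).head (path_ne_nil d)) = G.vertexOf ((path e).head (path_ne_nil e))
  no_backtracking : ∀ (r : ℕ) (d : D),
    ((fun l : List D => l.flatMap path)^[r] [d]).IsChain fun a b => b ≠ G.rev a

namespace TrainTrackMap

variable {D : Type*} {G : RibbonGraph D} (f : TrainTrackMap G)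

/-- The edge path `f ^ r (d)`. -/
def iter (r : ℕ) (d : D) : List D := (fun l : List D => l.flatMap f.path)^[r] [d]

theorem head?_iter (r : ℕ) (d : D) :
    (f.iter r d).head? = some ((fun a => (f.path a).head (f.path_ne_nil a))^[r] d) := by
  induction r with
  | zero => simp [iter]
  | succ r ih =>
    rw [iter, Function.iterate_succ_apply', Function.iterate_succ_apply', ← iter]
    cases h : f.iter r d with
    | nil => rw [h] at ih; simp at ih
    | cons a l =>
      rw [h, List.head?_cons, Option.some.injEq] at ih
      rw [← ih, List.flatMap_cons, List.head?_append_of_ne_nil _ (f.path_ne_nil a),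
        List.head?_eq_some_head]

/-- Two darts originating at the same vertex are in the same gate if, for some `r > 0`, their
images under `f ^ r` have a nontrivial common initial segment. -/
def gateSetoid : Setoid D where
  r d e := G.vertexOf d = G.vertexOf e ∧ ∃ r, 0 < r ∧ (f.iter r d).head? = (f.iter r e).head?
  iseqv :=
    { refl := fun d => ⟨rfl, 1, one_pos, rfl⟩
      symm := fun ⟨h, r, hr, h'⟩ => ⟨h.symm, r, hr, h'.symm⟩
      trans := by
        rintro a b c ⟨h1, r, hr, h1'⟩ ⟨h2, s, hs, h2'⟩
        refine ⟨h1.trans h2, r + s, by omega, ?_⟩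
        simp only [head?_iter, Option.some.injEq] at h1' h2' ⊢
        rw [add_comm r s, Function.iterate_add_apply, h1', ← Function.iterate_add_apply,
          add_comm s r, Function.iterate_add_apply, h2', ← Function.iterate_add_apply] }

/-- The gates of `G`; they are the switches of the train track. -/
def Gate : Type _ := Quotient f.gateSetoid

/-- The gate containing a dart. -/
def gateOf (d : D) : f.Gate := Quotient.mk _ d

/-- The vertex at which a gate lies. -/
def gateVertex : f.Gate → G.Vertex :=
  Quotient.lift G.vertexOf fun _ _ h => h.1

/-- Two different gates at the same vertex are joined by an infinitesimal edge if they contain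
darts `x`, `y` such that some `f ^ r (e)`, `r > 0`, runs in along one of `x`, `y` and immediately
out along the other. -/
def infinitesimal : SimpleGraph f.Gate where
  Adj γ δ := γ ≠ δ ∧ ∃ x y : D, f.gateOf x = γ ∧ f.gateOf y = δ ∧ G.vertexOf x = G.vertexOf y ∧
    ∃ (r : ℕ) (e : D), 0 < r ∧
      ([G.rev x, y] <:+: f.iter r e ∨ [G.rev y, x] <:+: f.iter r e)
  symm := ⟨by
    rintro γ δ ⟨h, x, y, hx, hy, hv, r, e, hr, h'⟩
    exact ⟨h.symm, y, x, hy, hx, hv.symm, r, e, hr, h'.symm⟩⟩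
  loopless := ⟨fun _ h => h.1 rfl⟩

/-! ### The train track `τ` -/

/-- The oriented branches of the train track `τ`: real edges (edges of `G`) and infinitesimal
edges. The switches of `τ` are the gates; at each switch the real branches lie on one side and
the infinitesimal branches on the other side. -/
abbrev Branch : Type _ := D ⊕ f.infinitesimal.Dart

/-- The switch at which an oriented branch starts. -/
def branchSrc : f.Branch → f.Gate
  | .inl d => f.gateOf d
  | .inr a => a.fst

/-- Reversal of an oriented branch. -/
def branchRev : f.Branch → f.Branch
  | .inl d => .inl (G.rev d)
  | .inr a => .inr a.symm

theorem branchRev_branchRev (b : f.Branch) : f.branchRev (f.branchRev b) = b := by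
  rcases b with d | a
  · simp [branchRev, G.rev_rev]
  · simp [branchRev]

theorem branchRev_ne (b : f.Branch) : f.branchRev b ≠ b := by
  rcases b with d | a
  · simpa [branchRev] using G.rev_ne d
  · simpa [branchRev] using a.symm_ne

/-- Two branches meeting at a switch form a corner (their angle is `0`) if they lie on the same
side of the switch; otherwise their angle is `π`. -/
def Corner (a b : f.Branch) : Prop := a.isLeft = b.isLeft

/-- `τ` is orientable: its branches can be oriented consistently, that is, whenever `a` ends at
the switch where `b` starts, then exactly if their angle is `π` do the oriented branches `a`, `b`
both agree or both disagree with the chosen orientation. Here `o a` says that the direction of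
`a` is the chosen one. -/
def Orientable : Prop :=
  ∃ o : f.Branch → Prop, (∀ a, o (f.branchRev a) ↔ ¬ o a) ∧
    ∀ a b, f.branchSrc (f.branchRev a) = f.branchSrc b → ((o a ↔ o b) ↔ ¬ f.Corner a b)

/-! ### The orientation cover of `τ` -/

/-- The orientation double cover `τ̃` of `τ` has as its switches over `γ` the two directions in
which one can pass through `γ`: sheet `0` is the direction from the real to the infinitesimal
side, sheet `1` the direction from the infinitesimal to the real side. The lift `(a, s)` of an
oriented branch `a` starts at `(branchSrc a, s)`; as `a` leaves its first switch and enters its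
last one on sides of the same kind, it ends at the other kind of direction. -/
def coverSrc (a : f.Branch × ZMod 2) : f.Gate × ZMod 2 := (f.branchSrc a.1, a.2)

/-- Reversal of an oriented branch of `τ̃`. -/
def coverRev (a : f.Branch × ZMod 2) : f.Branch × ZMod 2 := (f.branchRev a.1, a.2 + 1)

open scoped Classical in
/-- The number of corners of a closed path in `τ`, given by the cyclic sequence of its oriented
branches. -/
noncomputable def cornerCount (n : ℕ) (γ : ℕ → f.Branch) : ℕ :=
  ((Finset.range n).filter fun i => f.Corner (γ i) (γ (i + 1))).card

/-- The cover `τ̃ → τ` is the one determined by the parity of the number of corners: a lift of a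
closed path of length `n` in `τ` is closed if and only if the path has an even number of
corners. -/
theorem cover_lift_closed_iff (n : ℕ) (γ : ℕ → f.Branch) (γ' : ℕ → f.Branch × ZMod 2)
    (hclosed : γ n = γ 0) (hlift : ∀ i, (γ' i).1 = γ i)
    (hpath : ∀ i, f.coverSrc (f.coverRev (γ' i)) = f.coverSrc (γ' (i + 1))) :
    γ' n = γ' 0 ↔ Even (f.cornerCount n γ) := by
  classical
  have hs : ∀ i, (γ' (i + 1)).2 = (γ' i).2 + 1 := fun i => (congrArg Prod.snd (hpath i)).symm
  have hs' : ∀ i : ℕ, (γ' i).2 = (γ' 0).2 + i := by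
    intro i
    induction i with
    | zero => simp
    | succ i ih => rw [hs, ih]; push_cast; ring
  let t : f.Branch → ZMod 2 := fun a => if a.isLeft then 1 else 0
  have hone : ∀ x : ZMod 2, x + x = 0 := by decide
  have hc : ∀ a b : f.Branch, (if f.Corner a b then 1 else 0 : ZMod 2) = 1 + (t b - t a) := by
    rintro (a | a) (b | b) <;> simp [Corner, t] <;> decide
  have hcount : (f.cornerCount n γ : ZMod 2) = n := by
    rw [cornerCount, Finset.card_filter]
    push_cast
    rw [Finset.sum_congr rfl fun i _ => hc (γ i) (γ (i + 1)), Finset.sum_add_distrib,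
      Finset.sum_range_sub (fun i => t (γ i)), hclosed]
    simp
  rw [← ZMod.natCast_eq_zero_iff_even, hcount]
  constructor
  · intro h
    have h2 := hs' n
    rw [h] at h2
    simpa using h2
  · intro h
    refine Prod.ext ?_ ?_
    · rw [hlift, hlift, hclosed]
    · rw [hs', h, add_zero]

/-- The tautological orientation of `τ̃`: the oriented branch `(a, s)` is positive if, at its
origin, it points in the direction recorded by `s`. -/
def Positive (a : f.Branch × ZMod 2) : Prop :=
  (a.1.isLeft ∧ a.2 = 1) ∨ (a.1.isRight ∧ a.2 = 0)

theorem positive_coverRev (a : f.Branch × ZMod 2) :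
    f.Positive (f.coverRev a) ↔ ¬ f.Positive a := by
  rcases a with ⟨d | a, s⟩ <;> simp only [Positive, coverRev, branchRev] <;>
    revert s <;> simp <;> decide

/-! ### Transverse measures -/

variable [Fintype D]

instance : Finite f.Gate := Quotient.finite _

instance : Finite f.infinitesimal.Dart :=
  Finite.of_injective _ SimpleGraph.Dart.toProd_injective

noncomputable instance : Fintype f.infinitesimal.Dart := Fintype.ofFinite _

open scoped Classical in
/-- `W(τ)`: the real weights on the branches of `τ` satisfying the switch conditions: at every
switch the total weight of the branch ends on the real side equals that on the infinitesimal
side. -/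
noncomputable def Wτ : Submodule ℝ (f.Branch → ℝ) where
  carrier := {μ | (∀ b, μ (f.branchRev b) = μ b) ∧ ∀ γ : f.Gate,
    (∑ d : D, if f.gateOf d = γ then μ (.inl d) else 0) =
      ∑ a : f.infinitesimal.Dart, if a.fst = γ then μ (.inr a) else 0}
  zero_mem' := by simp
  add_mem' {μ ν} hμ hν := by
    refine ⟨fun b => by simp only [Pi.add_apply, hμ.1 b, hν.1 b], fun γ => ?_⟩
    simp only [Pi.add_apply, ← Finset.sum_filter, Finset.sum_add_distrib]
    simpa only [← Finset.sum_filter] using congrArg₂ (· + ·) (hμ.2 γ) (hν.2 γ)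
  smul_mem' r μ hμ := by
    refine ⟨fun b => by simp only [Pi.smul_apply, hμ.1 b], fun γ => ?_⟩
    simp only [Pi.smul_apply, smul_eq_mul, ← Finset.sum_filter, ← Finset.mul_sum]
    simpa only [← Finset.sum_filter] using congrArg (r * ·) (hμ.2 γ)

/-- The map `π_*` induced by the collapse `π : τ → G`: it restricts weights to the real edges. -/
def collapse : (f.Branch → ℝ) →ₗ[ℝ] (D → ℝ) := LinearMap.funLeft ℝ ℝ Sum.inl

/-- `W(G, f) = π_* (W(τ))`. -/
noncomputable def W : Submodule ℝ (D → ℝ) := f.Wτ.map f.collapse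

theorem W_le_V : f.W ≤ G.V := by
  rintro _ ⟨μ, hμ, rfl⟩ d
  exact hμ.1 (.inl d)

/-- `π_* : W(τ) → W(G, f)`. -/
noncomputable def collapseW : f.Wτ →ₗ[ℝ] f.W :=
  f.collapse.restrict fun _ hμ => Submodule.mem_map_of_mem hμ

/-! ### Infinitesimal polygons -/

/-- At every vertex `v` the infinitesimal edges form a polygon or a polygon with one side missing:
the `k v` gates at `v` can be numbered `gate v 0, …, gate v (k v - 1)` in the cyclic order around
`v` so that the infinitesimal edges at `v` join consecutive gates, except that for a partial
(= not complete) polygon the side between the last gate and `gate v 0` is missing. A complete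
polygon has at least three sides; a partial vertex with two gates is evanescent. -/
structure InfinitesimalPolygons where
  k : G.Vertex → ℕ
  k_pos : ∀ v, 0 < k v
  gate : ∀ v, ZMod (k v) ≃ {γ : f.Gate // f.gateVertex γ = v}
  cyclic_order : ∀ v, ∃ (d : D) (m : ℕ → ℕ), Monotone m ∧ m 0 = 0 ∧
    m (Nat.card {e : D // G.vertexOf e = v}) = k v ∧
    ∀ j ≤ Nat.card {e : D // G.vertexOf e = v},
      f.gateOf ((⇑G.next)^[j] d) = (gate v (m j : ZMod (k v))).1
  complete : G.Vertex → Prop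
  three_le : ∀ v, complete v → 3 ≤ k v
  adj_iff : ∀ v (i j : ZMod (k v)), f.infinitesimal.Adj (gate v i).1 (gate v j).1 ↔
    (j = i + 1 ∧ (complete v ∨ j ≠ 0)) ∨ (i = j + 1 ∧ (complete v ∨ i ≠ 0))

namespace InfinitesimalPolygons

variable {f} (P : f.InfinitesimalPolygons)

/-- The `i`-th side of the complete polygon at `v`, as an oriented infinitesimal edge. -/
def polygonSide (v : G.Vertex) (hv : P.complete v) (i : ZMod (P.k v)) : f.infinitesimal.Dart :=
  ⟨((P.gate v i).1, (P.gate v (i + 1)).1), (P.adj_iff v i (i + 1)).2 (.inl ⟨rfl, .inl hv⟩)⟩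

/-- The surface `S`, up to deformation retraction. The complement of `τ` in `S` consists of the
open discs bounded by the complete polygons and of once-punctured discs; so `S` deformation
retracts to the union of `τ` and the discs, which is the following cell complex. (Without the
discs one gets the surface `S'`, which has an additional puncture in each of them.) -/
noncomputable def surface : CellComplex where
  Vert := f.Gate
  Arc := f.Branch
  Face := {v : G.Vertex // P.complete v}
  fintypeArc := inferInstance
  src := f.branchSrc
  rev := f.branchRev
  rev_rev := f.branchRev_branchRev
  rev_ne := f.branchRev_ne
  len v := P.k v.1
  side v i := .inr (P.polygonSide v.1 v.2 (i : ZMod (P.k v.1)))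
  side_periodic v i := by simp
  side_next v i := by
    simp [TrainTrackMap.branchSrc, TrainTrackMap.branchRev, polygonSide, SimpleGraph.Dart.symm]

end InfinitesimalPolygons

/-! ### The orientation cover of `S` -/

namespace InfinitesimalPolygons

variable {f} (P : f.InfinitesimalPolygons)

/-- The orientation cover `S̃`, up to deformation retraction: the double cover `τ̃` of `τ` with
discs glued to the boundary loops that lie over the complete polygons (these loops go round the
punctures of the double cover of `S'` that are to be filled in). The boundary of a polygon with
an even number `k` of sides has two lifts, one starting on each sheet, each of length `k`; that
of a polygon with an odd number `k` of sides has a single preimage, of length `2 * k`. -/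
noncomputable def orientationCover : CellComplex where
  Vert := f.Gate × ZMod 2
  Arc := f.Branch × ZMod 2
  Face := {F : G.Vertex × ZMod 2 // P.complete F.1 ∧ (Odd (P.k F.1) → F.2 = 0)}
  fintypeArc := inferInstance
  src := f.coverSrc
  rev := f.coverRev
  rev_rev a := by
    refine Prod.ext (f.branchRev_branchRev a.1) ?_
    change a.2 + 1 + 1 = a.2
    generalize a.2 = s
    revert s
    decide
  rev_ne a h := f.branchRev_ne a.1 (congrArg Prod.fst h)
  len F := if Odd (P.k F.1.1) then 2 * P.k F.1.1 else P.k F.1.1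
  side F i := (.inr (P.polygonSide F.1.1 F.2.1 (i : ZMod (P.k F.1.1))), F.1.2 + (i : ZMod 2))
  side_periodic F i := by
    split_ifs with h
    · have h2 : (2 : ZMod 2) = 0 := by decide
      simp [h2]
    · rw [Nat.not_odd_iff_even] at h
      simp [(ZMod.natCast_eq_zero_iff_even).2 h]
  side_next F i := by
    simp [TrainTrackMap.coverSrc, TrainTrackMap.coverRev, TrainTrackMap.branchSrc,
      TrainTrackMap.branchRev, polygonSide, SimpleGraph.Dart.symm, add_assoc]

/-- The deck involution `ι` of `S̃`: it exchanges the sheets, hence the two discs over an even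
vertex, and it rotates the disc over an odd vertex by half a turn. -/
noncomputable def deck : P.orientationCover.Symmetry where
  vert := (Equiv.refl f.Gate).prodCongr (Equiv.addRight (1 : ZMod 2))
  arc := (Equiv.refl f.Branch).prodCongr (Equiv.addRight (1 : ZMod 2))
  face := Function.Involutive.toPerm
    (fun F => ⟨(F.1.1, if Odd (P.k F.1.1) then F.1.2 else F.1.2 + 1), F.2.1, fun h => by
      simpa only [h, if_true] using F.2.2 h⟩) (by
      have h2 : ∀ s : ZMod 2, s + 1 + 1 = s := by decide
      intro F
      refine Subtype.ext (Prod.ext rfl ?_)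
      by_cases h : Odd (P.k F.1.1)
      · simp only [h, if_true]
      · simp only [h, if_false, h2])
  src_arc a := rfl
  rev_arc a := rfl
  len_face F := rfl
  side_face F := by
    by_cases h : Odd (P.k F.1.1)
    · refine ⟨P.k F.1.1, fun i => Prod.ext ?_ ?_⟩
      · change Sum.inr (P.polygonSide F.1.1 F.2.1 (i : ZMod (P.k F.1.1))) =
          Sum.inr (P.polygonSide F.1.1 F.2.1 ((i + P.k F.1.1 : ℕ) : ZMod (P.k F.1.1)))
        simp
      · have h1 : ((P.k F.1.1 : ℕ) : ZMod 2) = 1 := (ZMod.natCast_eq_one_iff_odd).2 h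
        have h2 : ∀ s t : ZMod 2, s + t = s + (t + 1) + 1 := by decide
        change (if Odd (P.k F.1.1) then F.1.2 else F.1.2 + 1) + (i : ZMod 2) =
          F.1.2 + ((i + P.k F.1.1 : ℕ) : ZMod 2) + 1
        rw [if_pos h, Nat.cast_add, h1]
        exact h2 F.1.2 i
    · refine ⟨0, fun i => Prod.ext rfl ?_⟩
      change (if Odd (P.k F.1.1) then F.1.2 else F.1.2 + 1) + (i : ZMod 2) =
        F.1.2 + ((i + 0 : ℕ) : ZMod 2) + 1
      rw [if_neg h, Nat.add_zero]
      ring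

/-- `ι_* : H₁(S̃; ℝ) → H₁(S̃; ℝ)`. -/
noncomputable def deckOnH1 : Module.End ℝ P.orientationCover.H1 := P.deck.onH1

/-- The eigenspace `E⁺` of `ι_*` for the eigenvalue `1`. -/
noncomputable def Eplus : Submodule ℝ P.orientationCover.H1 := P.deckOnH1.eigenspace 1

/-- The eigenspace `E⁻` of `ι_*` for the eigenvalue `-1`. -/
noncomputable def Eminus : Submodule ℝ P.orientationCover.H1 := P.deckOnH1.eigenspace (-1)

/-- The lift of a 1-chain of `S` to its full preimage in `S̃`: both preimages of an oriented branch
get its coefficient. -/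
def liftChain (c : f.Branch → ℝ) : f.Branch × ZMod 2 → ℝ := fun a => c a.1

open scoped Classical in
/-- The lift `∑ b, μ b • (b̃ + b̃')` of branch weights to a 1-chain of `S̃`, where `b̃`, `b̃'` are the
two preimages of the branch `b`, both oriented by the tautological orientation of `τ̃`. -/
noncomputable def liftWeight (μ : f.Branch → ℝ) : f.Branch × ZMod 2 → ℝ :=
  fun a => if f.Positive a then μ a.1 else - μ a.1

theorem liftChain_mem_cycles (c : f.Branch → ℝ) (hc : c ∈ P.surface.cycles) :
    liftChain c ∈ P.orientationCover.cycles := by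
  classical
  obtain ⟨h1, h2⟩ := hc
  refine ⟨fun a => h1 a.1, LinearMap.mem_ker.2 (funext fun v => ?_)⟩
  obtain ⟨γ, s⟩ := v
  have h3 := congrFun (LinearMap.mem_ker.1 h2) γ
  change (∑ b : f.Branch, if f.branchSrc (f.branchRev b) = γ then c b else 0) = 0 at h3
  suffices h : (∑ a : f.Branch × ZMod 2,
      if (f.branchSrc (f.branchRev a.1), a.2 + 1) = (γ, s) then c a.1 else 0) = 0 by
    refine Eq.trans (Finset.sum_congr rfl fun a _ => ?_) h
    exact if_congr Iff.rfl rfl rfl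
  rw [Fintype.sum_prod_type]
  refine Eq.trans ?_ h3
  refine Finset.sum_congr rfl fun b _ => ?_
  simp only [Prod.mk.injEq]
  rw [Finset.sum_eq_single (s - 1)]
  · simp
  · intro t _ ht
    rw [if_neg]
    rintro ⟨_, rfl⟩
    simp at ht
  · simp

theorem liftWeight_mem_cycles (μ : f.Branch → ℝ) (hμ : μ ∈ f.Wτ) :
    liftWeight μ ∈ P.orientationCover.cycles := by
  classical
  have hrev : ∀ a : f.Branch × ZMod 2, liftWeight μ (f.coverRev a) = - liftWeight μ a := by
    intro a
    have h : μ (f.coverRev a).1 = μ a.1 := hμ.1 a.1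
    simp only [liftWeight, f.positive_coverRev, h]
    split_ifs <;> simp_all
  refine ⟨hrev, LinearMap.mem_ker.2 (funext fun v => ?_)⟩
  obtain ⟨γ, s⟩ := v
  let R : f.Branch × ZMod 2 ≃ f.Branch × ZMod 2 :=
    Function.Involutive.toPerm f.coverRev P.orientationCover.rev_rev
  suffices h : (∑ a : f.Branch × ZMod 2,
      if f.coverSrc (f.coverRev a) = (γ, s) then liftWeight μ a else 0) = 0 by
    refine Eq.trans (Finset.sum_congr rfl fun a _ => ?_) h
    exact if_congr Iff.rfl rfl rfl
  have h1 : (∑ a : f.Branch × ZMod 2,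
      if f.coverSrc (f.coverRev a) = (γ, s) then liftWeight μ a else 0) =
      ∑ a : f.Branch × ZMod 2, if f.coverSrc a = (γ, s) then - liftWeight μ a else 0 := by
    rw [← Equiv.sum_comp R]
    refine Finset.sum_congr rfl fun a _ => ?_
    have h : f.coverRev (R a) = a := P.orientationCover.rev_rev a
    rw [h]
    have h' : liftWeight μ (R a) = - liftWeight μ a := hrev a
    rw [h']
  have h2 : ∀ b : f.Branch, (∑ t : ZMod 2,
      if f.coverSrc (b, t) = (γ, s) then - liftWeight μ (b, t) else 0) =
      if f.branchSrc b = γ then - liftWeight μ (b, s) else 0 := by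
    intro b
    rw [Finset.sum_eq_single s]
    · simp [coverSrc]
    · intro t _ ht
      simp [coverSrc, ht]
    · simp
  have h3 := hμ.2 γ
  have hs : s = 0 ∨ s = 1 := (by decide : ∀ s : ZMod 2, s = 0 ∨ s = 1) s
  rw [h1, Fintype.sum_prod_type]
  simp only [h2, Fintype.sum_sum_type]
  simp only [branchSrc, liftWeight, Positive]
  simp only [← Finset.sum_filter] at h3 ⊢
  rcases hs with rfl | rfl <;>
    simp [← Finset.sum_filter, Finset.sum_neg_distrib, h3]

/-- The lift of 1-cycles of `S` to 1-cycles of `S̃`. -/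
noncomputable def liftCycle (c : P.surface.cycles) : P.orientationCover.cycles :=
  ⟨liftChain c.1, P.liftChain_mem_cycles c.1 c.2⟩

/-- The lift of elements of `W(τ)` to 1-cycles of `S̃`. -/
noncomputable def liftMeasure (μ : f.Wτ) : P.orientationCover.cycles :=
  ⟨liftWeight μ.1, P.liftWeight_mem_cycles μ.1 μ.2⟩

end InfinitesimalPolygons

end TrainTrackMap

/-! Since `ι` is an involution and 2 is invertible, `x = (x + ι x)/2 + (x - ι x)/2` splits the
homology into the two eigenspaces. Each eigenspace is then identified by the same scheme: two
surjections with a common source and equal kernels have isomorphic targets.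

For `E⁺` this is the transfer. Lifting a chain and pushing it down doubles it; pushing down and
lifting gives `z + ι z`. Both operations preserve boundaries, because the preimage of a polygon disc
consists of discs: two copies if the polygon is even, one disc branched over the centre if it is
odd. Hence a cycle of `S` bounds iff its lift does, and every invariant class is a lift.

For `E⁻`, the deck involution reverses the tautological orientation of `τ̃`, so an anti-invariant
chain is a weight on unoriented branches of `τ`, and being a cycle amounts to the switch conditions.
Thus `W(τ)` maps onto `E⁻`. The kernel consists of the weights vanishing on the real edges, which is
also the kernel of `π_*` (`liftWeight_mem_boundaries_iff`). In one direction, 2-cells touch only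
infinitesimal edges. Conversely, without real weights the switch conditions make the weights
alternate in sign around each polygon. They vanish at a partial vertex, because of the missing side,
and at an odd one, because of parity; at an even vertex they are `w, -w, w, …`, and the lift is `w`
times the difference of the boundaries of the two discs over the polygon. -/

/-! ### Linear algebra. -/

theorem exists_linearEquiv_of_ker_eq {R M N Q : Type*} [Ring R] [AddCommGroup M] [AddCommGroup N]
    [AddCommGroup Q] [Module R M] [Module R N] [Module R Q] (p : M →ₗ[R] N) (g : M →ₗ[R] Q)
    (hp : Function.Surjective p) (hg : Function.Surjective g)
    (hker : LinearMap.ker p = LinearMap.ker g) :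
    ∃ Φ : N ≃ₗ[R] Q, ∀ x, Φ (p x) = g x := by
  refine ⟨(p.quotKerEquivOfSurjective hp).symm ≪≫ₗ Submodule.quotEquivOfEq _ _ hker ≪≫ₗ
    g.quotKerEquivOfSurjective hg, fun x => ?_⟩
  have h : (p.quotKerEquivOfSurjective hp).symm (p x) = Submodule.Quotient.mk x := by
    rw [LinearEquiv.symm_apply_eq]
    rfl
  simp only [LinearEquiv.trans_apply, h]
  rfl

theorem isCompl_eigenspace_of_involutive {M : Type*} [AddCommGroup M] [Module ℝ M]
    (L : Module.End ℝ M) (hL : ∀ x, L (L x) = x) :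
    IsCompl (L.eigenspace 1) (L.eigenspace (-1)) := by
  refine IsCompl.of_eq ?_ ?_
  · refine (Submodule.eq_bot_iff _).2 fun x hx => ?_
    have h1 := Module.End.mem_eigenspace_iff.1 hx.1
    have h2 := Module.End.mem_eigenspace_iff.1 hx.2
    rw [h1, one_smul, neg_one_smul] at h2
    have h3 : (2 : ℝ) • x = 0 := by
      rw [two_smul]
      nth_rw 1 [h2]
      exact neg_add_cancel x
    exact (smul_eq_zero.1 h3).resolve_left two_ne_zero
  · refine eq_top_iff.2 fun x _ => Submodule.mem_sup.2
      ⟨(1 / 2 : ℝ) • (x + L x), ?_, (1 / 2 : ℝ) • (x - L x), ?_, ?_⟩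
    · rw [Module.End.mem_eigenspace_iff, map_smul, map_add, hL]
      module
    · rw [Module.End.mem_eigenspace_iff, map_smul, map_sub, hL]
      module
    · module

/-! ### Cellular chains. -/

namespace CellComplex

variable (X : CellComplex)

theorem homologyClass_eq_zero_iff (c : X.cycles) :
    X.homologyClass c = 0 ↔ c.1 ∈ X.boundaries := by
  rw [homologyClass, Submodule.mkQ_apply, Submodule.Quotient.mk_eq_zero]
  exact Iff.rfl

-- Reversal exchanges edges ending at `v` with edges starting there and only changes the sign of the
-- coefficients. The switch conditions are stated at the origins of branches, so this is the form of
-- the cycle condition to compare with them.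
open scoped Classical in
theorem sum_src_eq_zero (c : X.Arc → ℝ) (hc : c ∈ X.cycles) (v : X.Vert) :
    (∑ a, if X.src a = v then c a else 0) = 0 := by
  have h := congrFun (LinearMap.mem_ker.1 hc.2) v
  change (∑ a, if X.src (X.rev a) = v then c a else 0) = 0 at h
  rw [← Equiv.sum_comp (Function.Involutive.toPerm X.rev X.rev_rev)] at h
  have h2 : (∑ a, if X.src a = v then -c a else 0) = 0 := by
    refine Eq.trans (Finset.sum_congr rfl fun a _ => ?_) h
    change _ = if X.src (X.rev (X.rev a)) = v then c (X.rev a) else 0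
    rw [X.rev_rev, hc.1 a]
  rw [← neg_eq_zero, ← Finset.sum_neg_distrib]
  exact Eq.trans (Finset.sum_congr rfl fun a _ => by split_ifs <;> simp) h2

theorem homologyClass_surjective : Function.Surjective X.homologyClass :=
  Submodule.mkQ_surjective _

/-- A chain supported on a family of edges is the combination of these edges. -/
theorem eq_sum_arcChain {κ : Type*} (s : Finset κ) (a : κ → X.Arc) (c : X.Arc → ℝ)
    (hc : c ∈ X.chains) (hinj : Set.InjOn a s)
    (hrev : ∀ i ∈ s, ∀ j ∈ s, a i ≠ X.rev (a j))
    (hsupp : ∀ b, c b ≠ 0 → ∃ i ∈ s, b = a i ∨ b = X.rev (a i)) :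
    c = ∑ i ∈ s, c (a i) • arcChain (a i) (X.rev (a i)) := by
  classical
  -- At `a i` only the `i`-th summand survives. The coefficients at the reversed edges then agree
  -- because both sides are alternating.
  have hpos : ∀ i ∈ s, c (a i) = (∑ j ∈ s, c (a j) • arcChain (a j) (X.rev (a j))) (a i) := by
    intro i hi
    rw [Finset.sum_apply, Finset.sum_eq_single i]
    · simp [arcChain, (X.rev_ne (a i)).symm]
    · intro j hj hji
      have h1 : a i ≠ a j := fun h => hji (hinj hj hi h.symm)
      simp [arcChain, h1, hrev i hi j hj]
    · exact fun h => absurd hi h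
  have hmem : ∑ i ∈ s, c (a i) • arcChain (a i) (X.rev (a i)) ∈ X.chains :=
    Submodule.sum_mem _ fun i _ => Submodule.smul_mem _ _ (X.arcChain_mem_chains _)
  funext b
  by_cases hb : ∃ i ∈ s, b = a i ∨ b = X.rev (a i)
  · obtain ⟨i, hi, rfl | rfl⟩ := hb
    · exact hpos i hi
    · rw [hc, hmem, hpos i hi]
  · have h0 : c b = 0 := by
      by_contra h
      exact hb (hsupp b h)
    rw [h0, Finset.sum_apply]
    refine (Finset.sum_eq_zero fun i hi => ?_).symm
    have h1 : b ≠ a i := fun h => hb ⟨i, hi, .inl h⟩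
    have h2 : b ≠ X.rev (a i) := fun h => hb ⟨i, hi, .inr h⟩
    simp [arcChain, h1, h2]

end CellComplex

namespace TrainTrackMap

variable {D : Type*} {G : RibbonGraph D} {f : TrainTrackMap G}

theorem zmod_two_add_one_add_one (s : ZMod 2) : s + 1 + 1 = s := by
  revert s
  decide

/-! ### Transfer between chains of `S` and of `S̃`. -/

namespace InfinitesimalPolygons

/-- The push-forward of 1-chains along the covering `S̃ → S`. -/
def pushChain : (f.Branch × ZMod 2 → ℝ) →ₗ[ℝ] (f.Branch → ℝ) where
  toFun c b := c (b, 0) + c (b, 1)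
  map_add' c d := by
    funext b
    simp only [Pi.add_apply]
    ring
  map_smul' r c := by
    funext b
    simp only [Pi.smul_apply, smul_eq_mul, RingHom.id_apply]
    ring

theorem pushChain_apply (c : f.Branch × ZMod 2 → ℝ) (b : f.Branch) (s : ZMod 2) :
    pushChain c b = c (b, s) + c (b, s + 1) := by
  have hs : s = 0 ∨ s = 1 := (by decide : ∀ s : ZMod 2, s = 0 ∨ s = 1) s
  have h2 : (1 + 1 : ZMod 2) = 0 := by decide
  rcases hs with rfl | rfl
  · rw [zero_add]
    rfl
  · rw [h2]
    exact add_comm _ _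

theorem pushChain_arcChain (b b' : f.Branch) (s t : ZMod 2) :
    pushChain (arcChain (b, s) (b', t)) = arcChain b b' := by
  classical
  funext e
  have hs : ∀ s : ZMod 2, s = 0 ∨ s = 1 := by decide
  change arcChain (b, s) (b', t) (e, 0) + arcChain (b, s) (b', t) (e, 1) = _
  rcases hs s with rfl | rfl <;> rcases hs t with rfl | rfl <;> simp [arcChain] <;>
    split_ifs <;> norm_num

theorem liftChain_arcChain (b b' : f.Branch) (s : ZMod 2) :
    liftChain (arcChain b b') =
      arcChain (b, s) (b', s + 1) + arcChain (b, s + 1) (b', s + 1 + 1) := by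
  classical
  funext ⟨e, t⟩
  have hs : ∀ s : ZMod 2, s = 0 ∨ s = 1 := by decide
  have h2 : (1 + 1 : ZMod 2) = 0 := by decide
  rcases hs s with rfl | rfl <;> rcases hs t with rfl | rfl <;>
    simp [arcChain, liftChain, h2] <;> split_ifs <;> norm_num

theorem liftChain_sum {κ : Type*} (s : Finset κ) (c : κ → f.Branch → ℝ) :
    liftChain (∑ i ∈ s, c i) = ∑ i ∈ s, liftChain (c i) := by
  funext a
  simp [liftChain, Finset.sum_apply]

/-- The oriented edge of `S` on the boundary of the polygon at `v`, as a 1-chain. -/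
noncomputable def sideChain (P : f.InfinitesimalPolygons) (v : G.Vertex) (hv : P.complete v) (i : ℕ) : f.Branch → ℝ :=
  arcChain (.inr (P.polygonSide v hv i)) (f.branchRev (.inr (P.polygonSide v hv i)))

/-- The lift of an oriented side of the polygon at `v` starting on the sheet `s`, as a 1-chain. -/
noncomputable def coverSideChain (P : f.InfinitesimalPolygons) (v : G.Vertex) (hv : P.complete v) (i : ℕ) (s : ZMod 2) :
    f.Branch × ZMod 2 → ℝ :=
  arcChain (.inr (P.polygonSide v hv i), s)
    (f.coverRev (.inr (P.polygonSide v hv i), s))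

/-- Used for the second turn that the boundary of the disc over an odd polygon makes around it. -/
theorem sideChain_add (P : f.InfinitesimalPolygons) (v : G.Vertex) (hv : P.complete v) (i : ℕ) :
    P.sideChain v hv (P.k v + i) = P.sideChain v hv i := by
  simp [sideChain]

theorem coverSideChain_add (P : f.InfinitesimalPolygons) (v : G.Vertex) (hv : P.complete v) (i : ℕ) (s : ZMod 2) :
    P.coverSideChain v hv (P.k v + i) s = P.coverSideChain v hv i s := by
  simp [coverSideChain]

theorem pushChain_coverSideChain (P : f.InfinitesimalPolygons) (v : G.Vertex) (hv : P.complete v) (i : ℕ) (s : ZMod 2) :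
    pushChain (P.coverSideChain v hv i s) = P.sideChain v hv i :=
  pushChain_arcChain _ _ _ _

theorem liftChain_sideChain (P : f.InfinitesimalPolygons) (v : G.Vertex) (hv : P.complete v) (i : ℕ) (s : ZMod 2) :
    liftChain (P.sideChain v hv i) =
      P.coverSideChain v hv i s + P.coverSideChain v hv i (s + 1) :=
  liftChain_arcChain _ _ _

/-! ### The deck involution on homology. -/

section Covering

variable [Fintype D] (P : f.InfinitesimalPolygons)

theorem deck_onChains_apply (c : f.Branch × ZMod 2 → ℝ) (a : f.Branch × ZMod 2) :
    P.deck.onChains c a = c (a.1, a.2 + 1) := by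
  have h : P.deck.arc.symm a = (a.1, a.2 + 1) :=
    (Equiv.symm_apply_eq P.deck.arc).2 (Prod.ext rfl (zmod_two_add_one_add_one a.2).symm)
  exact congrArg c h

theorem deckOnH1_homologyClass (z : P.orientationCover.cycles) :
    P.deckOnH1 (P.orientationCover.homologyClass z) =
      P.orientationCover.homologyClass (P.deck.onCycles z) := rfl

theorem deckOnH1_deckOnH1 (x : P.orientationCover.H1) : P.deckOnH1 (P.deckOnH1 x) = x := by
  obtain ⟨z, rfl⟩ := P.orientationCover.homologyClass_surjective x
  rw [deckOnH1_homologyClass, deckOnH1_homologyClass]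
  congr 1
  refine Subtype.ext (funext fun a => ?_)
  refine (P.deck_onChains_apply _ a).trans ((P.deck_onChains_apply z.1 _).trans ?_)
  exact congrArg z.1 (Prod.ext rfl (zmod_two_add_one_add_one a.2))

theorem mem_Eplus_iff (x : P.orientationCover.H1) : x ∈ P.Eplus ↔ P.deckOnH1 x = x := by
  rw [Eplus, Module.End.mem_eigenspace_iff, one_smul]

theorem mem_Eminus_iff (x : P.orientationCover.H1) : x ∈ P.Eminus ↔ P.deckOnH1 x = -x := by
  rw [Eminus, Module.End.mem_eigenspace_iff, neg_one_smul]

/-! ### The invariant part -/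

theorem pushChain_mem_cycles (c : f.Branch × ZMod 2 → ℝ) (hc : c ∈ P.orientationCover.cycles) :
    pushChain c ∈ P.surface.cycles := by
  classical
  obtain ⟨h1, h2⟩ := hc
  refine ⟨fun b => ?_, LinearMap.mem_ker.2 (funext fun (γ : f.Gate) => ?_)⟩
  · have h3 := h1 (b, 0)
    have h4 := h1 (b, 1)
    change c (f.branchRev b, 0 + 1) = _ at h3
    change c (f.branchRev b, 1 + 1) = _ at h4
    change pushChain c (f.branchRev b) = _
    rw [pushChain_apply c (f.branchRev b) (0 + 1)]
    rw [h3, zero_add, h4, pushChain_apply c b 0, zero_add]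
    ring
  · have h3 : ∀ s : ZMod 2, (∑ a : f.Branch × ZMod 2,
        if (f.branchSrc (f.branchRev a.1), a.2 + 1) = (γ, s) then c a else 0) = 0 := by
      intro s
      refine Eq.trans (Finset.sum_congr rfl fun a _ => ?_)
        (congrFun (LinearMap.mem_ker.1 h2) (γ, s))
      exact if_congr Iff.rfl rfl rfl
    -- A lift starting on sheet `s` ends on sheet `s + 1`, so the boundary at `(γ, s + 1)` involves
    -- sheet `s` only.
    have h4 : ∀ s : ZMod 2, (∑ b : f.Branch,
        if f.branchSrc (f.branchRev b) = γ then c (b, s) else 0) = 0 := by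
      intro s
      refine Eq.trans ?_ (h3 (s + 1))
      rw [Fintype.sum_prod_type]
      refine Finset.sum_congr rfl fun b _ => ?_
      rw [Finset.sum_eq_single s]
      · simp only [Prod.mk.injEq, and_true]
      · intro t _ ht
        simp only [Prod.mk.injEq, add_left_inj, ht, and_false, if_false]
      · simp
    have h5 : (∑ b : f.Branch,
        if f.branchSrc (f.branchRev b) = γ then c (b, 0) + c (b, 1) else 0) = 0 := by
      have h6 := congrArg₂ (· + ·) (h4 0) (h4 1)
      simp only [← Finset.sum_filter, ← Finset.sum_add_distrib, add_zero] at h6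
      rw [← Finset.sum_filter]
      exact h6
    refine Eq.trans (Finset.sum_congr rfl fun b _ => ?_) h5
    exact if_congr Iff.rfl rfl rfl

theorem surface_faceBoundary (v : {v : G.Vertex // P.complete v}) :
    P.surface.faceBoundary v = ∑ i ∈ Finset.range (P.k v.1), P.sideChain v.1 v.2 i := rfl

theorem orientationCover_faceBoundary (F : P.orientationCover.Face) :
    P.orientationCover.faceBoundary F =
      ∑ i ∈ Finset.range (if Odd (P.k F.1.1) then 2 * P.k F.1.1 else P.k F.1.1),
        P.coverSideChain F.1.1 F.2.1 i (F.1.2 + (i : ZMod 2)) := rfl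

theorem sum_coverSideChain_mem_of_odd (v : G.Vertex) (hv : P.complete v) (hk : Odd (P.k v)) :
    (∑ i ∈ Finset.range (2 * P.k v), P.coverSideChain v hv i (i : ZMod 2)) ∈
      P.orientationCover.boundaries := by
  refine Submodule.subset_span ⟨⟨(v, 0), hv, fun _ => rfl⟩, ?_⟩
  refine (P.orientationCover_faceBoundary _).trans ?_
  change (∑ i ∈ Finset.range (if Odd (P.k v) then 2 * P.k v else P.k v),
    P.coverSideChain v hv i (0 + (i : ZMod 2))) = _
  simp only [if_pos hk, zero_add]

theorem sum_coverSideChain_mem_of_not_odd (v : G.Vertex) (hv : P.complete v)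
    (hk : ¬ Odd (P.k v)) (s : ZMod 2) :
    (∑ i ∈ Finset.range (P.k v), P.coverSideChain v hv i (s + (i : ZMod 2))) ∈
      P.orientationCover.boundaries := by
  refine Submodule.subset_span ⟨⟨(v, s), hv, fun h => absurd h hk⟩, ?_⟩
  refine (P.orientationCover_faceBoundary _).trans ?_
  change (∑ i ∈ Finset.range (if Odd (P.k v) then 2 * P.k v else P.k v),
    P.coverSideChain v hv i (s + (i : ZMod 2))) = _
  rw [if_neg hk]

/-- A disc over an even polygon covers it once. The disc over an odd polygon covers it twice, so its
boundary is pushed to twice the boundary below. -/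
theorem pushChain_mem_boundaries (c : f.Branch × ZMod 2 → ℝ)
    (hc : c ∈ P.orientationCover.boundaries) : pushChain c ∈ P.surface.boundaries := by
  have : P.orientationCover.boundaries ≤ P.surface.boundaries.comap pushChain := by
    refine Submodule.span_le.2 ?_
    rintro _ ⟨F, rfl⟩
    have hF : (∑ i ∈ Finset.range (P.k F.1.1), P.sideChain F.1.1 F.2.1 i) ∈
        P.surface.boundaries := Submodule.subset_span ⟨⟨F.1.1, F.2.1⟩, rfl⟩
    change pushChain (P.orientationCover.faceBoundary F) ∈ P.surface.boundaries
    rw [orientationCover_faceBoundary, map_sum]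
    simp only [pushChain_coverSideChain]
    split_ifs
    · rw [two_mul, Finset.sum_range_add]
      simp only [sideChain_add]
      exact add_mem hF hF
    · exact hF
  exact this hc

/-- The lifted boundary of a polygon is the boundary of everything over it: the single `2k`-gon for
odd `k`, the sum of the two `k`-gons for even `k`. -/
theorem liftChain_mem_boundaries (c : f.Branch → ℝ) (hc : c ∈ P.surface.boundaries) :
    liftChain c ∈ P.orientationCover.boundaries := by
  have : P.surface.boundaries ≤
      P.orientationCover.boundaries.comap (LinearMap.funLeft ℝ ℝ Prod.fst) := by
    refine Submodule.span_le.2 ?_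
    rintro _ ⟨⟨v, hv⟩, rfl⟩
    change liftChain (P.surface.faceBoundary ⟨v, hv⟩) ∈ P.orientationCover.boundaries
    rw [surface_faceBoundary, liftChain_sum]
    change (∑ i ∈ Finset.range (P.k v), liftChain (P.sideChain v hv i)) ∈ _
    by_cases hk : Odd (P.k v)
    · have h1 : ((P.k v : ℕ) : ZMod 2) = 1 := (ZMod.natCast_eq_one_iff_odd).2 hk
      have h := P.sum_coverSideChain_mem_of_odd v hv hk
      rw [two_mul, Finset.sum_range_add] at h
      refine (congrArg (· ∈ P.orientationCover.boundaries) ?_).mpr h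
      refine Eq.trans (Finset.sum_congr rfl fun i _ => ?_) Finset.sum_add_distrib
      -- The `2k`-gon meets the lifts of side `i` at steps `i` and `k + i`; these lie on different
      -- sheets because `k` is odd.
      rw [P.liftChain_sideChain v hv i (i : ZMod 2)]
      simp only [coverSideChain_add, Nat.cast_add, h1, add_comm (1 : ZMod 2)]
      rfl
    · have h := add_mem (P.sum_coverSideChain_mem_of_not_odd v hv hk 0)
        (P.sum_coverSideChain_mem_of_not_odd v hv hk 1)
      refine (congrArg (· ∈ P.orientationCover.boundaries) ?_).mpr h
      refine Eq.trans (Finset.sum_congr rfl fun i _ => ?_) Finset.sum_add_distrib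
      -- The lifts of side `i` on the sheets `i` and `i + 1` belong to the discs starting on sheets
      -- `0` and `1`.
      rw [P.liftChain_sideChain v hv i (i : ZMod 2), zero_add, add_comm (1 : ZMod 2)]
      rfl
  exact this hc

theorem liftChain_mem_boundaries_iff (c : f.Branch → ℝ) :
    liftChain c ∈ P.orientationCover.boundaries ↔ c ∈ P.surface.boundaries := by
  refine ⟨fun h => ?_, P.liftChain_mem_boundaries c⟩
  -- Pushing the lift of `c` down gives `2c`.
  have h1 := P.surface.boundaries.smul_mem (1 / 2 : ℝ) (P.pushChain_mem_boundaries _ h)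
  refine (congrArg (· ∈ P.surface.boundaries) (funext fun b => ?_)).mpr h1
  change c b = 1 / 2 * (c b + c b)
  ring

/-- The class of the full preimage of a cycle, as a linear map to `E⁺`. -/
noncomputable def liftCycleClass : P.surface.cycles →ₗ[ℝ] P.Eplus where
  toFun c := ⟨P.orientationCover.homologyClass (P.liftCycle c), by
    rw [mem_Eplus_iff, deckOnH1_homologyClass]
    exact congrArg _ (Subtype.ext (funext fun a => P.deck_onChains_apply (liftChain c.1) a))⟩
  map_add' c d := Subtype.ext (map_add P.orientationCover.homologyClass (P.liftCycle c) (P.liftCycle d))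
  map_smul' r c := Subtype.ext (map_smul P.orientationCover.homologyClass r (P.liftCycle c))

/-- The lift of half the push-forward of `z` is the average `(z + ι z)/2`, which represents the
class of `z` when that class is invariant. -/
theorem liftCycleClass_surjective : Function.Surjective P.liftCycleClass := by
  rintro ⟨x, hx⟩
  rw [mem_Eplus_iff] at hx
  obtain ⟨z, rfl⟩ := P.orientationCover.homologyClass_surjective x
  refine ⟨(1 / 2 : ℝ) • ⟨pushChain z.1, P.pushChain_mem_cycles z.1 z.2⟩, ?_⟩
  rw [map_smul]
  refine Subtype.ext ?_
  have h : P.liftCycle ⟨pushChain z.1, P.pushChain_mem_cycles z.1 z.2⟩ =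
      z + P.deck.onCycles z := by
    refine Subtype.ext (funext fun a => ?_)
    change pushChain z.1 a.1 = z.1 a + P.deck.onChains z.1 a
    exact (pushChain_apply z.1 a.1 a.2).trans
      (congrArg (z.1 a + ·) (P.deck_onChains_apply z.1 a).symm)
  change (1 / 2 : ℝ) • P.orientationCover.homologyClass (P.liftCycle
    ⟨pushChain z.1, P.pushChain_mem_cycles z.1 z.2⟩) = P.orientationCover.homologyClass z
  rw [h, map_add, ← deckOnH1_homologyClass, hx]
  module

theorem ker_homologyClass_eq_ker_liftCycleClass :
    LinearMap.ker P.surface.homologyClass = LinearMap.ker P.liftCycleClass := by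
  ext c
  rw [LinearMap.mem_ker, LinearMap.mem_ker, CellComplex.homologyClass_eq_zero_iff,
    Subtype.ext_iff]
  refine (P.liftChain_mem_boundaries_iff c.1).symm.trans ?_
  exact (P.orientationCover.homologyClass_eq_zero_iff (P.liftCycle c)).symm

end Covering

end InfinitesimalPolygons

theorem gateVertex_eq_of_adj {γ δ : f.Gate} (h : f.infinitesimal.Adj γ δ) :
    f.gateVertex γ = f.gateVertex δ := by
  obtain ⟨-, x, y, rfl, rfl, hv, -⟩ := h
  exact hv

/-- The two equations force `2 = 0` in `ZMod k`. This isolates the degenerate vertices with one or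
two gates, where each of two gates is the successor of the other. -/
theorem zmod_eq_zero_or_of_two_step {k : ℕ} {i j : ZMod k} (hj : j = i + 1) (hi : i = j + 1) :
    k ≤ 2 ∧ (i = 0 ∨ j = 0) := by
  have h : ((2 : ℕ) : ZMod k) = 0 := by
    have h1 : i = i + 1 + 1 := by rw [← hj, ← hi]
    rw [add_assoc, left_eq_add] at h1
    push_cast
    rw [← one_add_one_eq_two]
    exact h1
  rw [ZMod.natCast_eq_zero_iff] at h
  have hk := Nat.le_of_dvd two_pos h
  refine ⟨hk, ?_⟩
  interval_cases k
  · omega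
  · exact .inl (Subsingleton.elim _ _)
  · clear h hk hi
    revert i j
    decide

/-- The deck involution reverses the tautological orientation; this is why lifted weights are
anti-invariant. -/
theorem positive_sheet (a : f.Branch × ZMod 2) :
    f.Positive (a.1, a.2 + 1) ↔ ¬ f.Positive a := by
  rcases a with ⟨d | a, s⟩ <;> simp only [Positive] <;> revert s <;> simp <;> decide

namespace InfinitesimalPolygons

theorem liftWeight_sheet (μ : f.Branch → ℝ) (a : f.Branch × ZMod 2) :
    liftWeight μ (a.1, a.2 + 1) = -liftWeight μ a := by
  classical
  simp only [liftWeight, positive_sheet]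
  split_ifs <;> simp_all

theorem liftWeight_inl (μ : f.Branch → ℝ) (d : D) : liftWeight μ (.inl d, 1) = μ (.inl d) := by
  simp [liftWeight, Positive]

theorem liftWeight_inr (μ : f.Branch → ℝ) (a : f.infinitesimal.Dart) :
    liftWeight μ (.inr a, 0) = μ (.inr a) := by
  simp [liftWeight, Positive]

theorem liftWeight_inr_one (μ : f.Branch → ℝ) (a : f.infinitesimal.Dart) :
    liftWeight μ (.inr a, 1) = -μ (.inr a) := by
  simp [liftWeight, Positive]

/-! ### The anti-invariant part -/

/-- The branch weights whose lift is the anti-invariant part of a 1-chain. -/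
def pushWeight (c : f.Branch × ZMod 2 → ℝ) : f.Branch → ℝ
  -- The plus sign goes to the positive lift: sheet `1` for real branches, sheet `0` for
  -- infinitesimal ones.
  | .inl d => c (.inl d, 1) - c (.inl d, 0)
  | .inr a => c (.inr a, 0) - c (.inr a, 1)

theorem liftWeight_pushWeight (c : f.Branch × ZMod 2 → ℝ) (a : f.Branch × ZMod 2) :
    liftWeight (pushWeight c) a = c a - c (a.1, a.2 + 1) := by
  have h2 : (1 + 1 : ZMod 2) = 0 := by decide
  obtain ⟨b, s⟩ := a
  have hs : s = 0 ∨ s = 1 := (by decide : ∀ s : ZMod 2, s = 0 ∨ s = 1) s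
  rcases b with d | a <;> rcases hs with rfl | rfl <;>
    simp [liftWeight, Positive, pushWeight, h2]

/-! ### Infinitesimal edges around a vertex. -/

section Polygon

variable (P : f.InfinitesimalPolygons)

theorem exists_gate_eq (v : G.Vertex) (γ : f.Gate) (h : f.gateVertex γ = v) :
    ∃ i, γ = (P.gate v i).1 :=
  ⟨(P.gate v).symm ⟨γ, h⟩, by simp⟩

open scoped Classical in
/-- The weight of the infinitesimal edge joining two gates, if there is one. -/
noncomputable def edgeWeight (μ : f.Branch → ℝ) (γ δ : f.Gate) : ℝ :=
  if h : f.infinitesimal.Adj γ δ then μ (.inr ⟨(γ, δ), h⟩) else 0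

open scoped Classical in
/-- The weight of the `i`-th side of the possibly partial polygon at `v`. -/
noncomputable def sideWeight (μ : f.Branch → ℝ) (v : G.Vertex) (i : ZMod (P.k v)) : ℝ :=
  -- The side missing from a partial polygon is the one ending at gate `0`. Giving it weight `0`
  -- lets complete and partial vertices share the same formulas, also when two gates are joined by
  -- the other side of a bigon.
  if P.complete v ∨ i + 1 ≠ 0 then edgeWeight μ (P.gate v i).1 (P.gate v (i + 1)).1 else 0

theorem edgeWeight_dart (μ : f.Branch → ℝ) (a : f.infinitesimal.Dart) :
    edgeWeight μ a.fst a.snd = μ (.inr a) :=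
  dif_pos a.adj

theorem edgeWeight_comm (μ : f.Branch → ℝ) (hμ : ∀ b, μ (f.branchRev b) = μ b) (γ δ : f.Gate) :
    edgeWeight μ γ δ = edgeWeight μ δ γ := by
  by_cases h : f.infinitesimal.Adj γ δ
  · rw [edgeWeight, edgeWeight, dif_pos h, dif_pos h.symm]
    exact (hμ (.inr ⟨(γ, δ), h⟩)).symm
  · rw [edgeWeight, edgeWeight, dif_neg h, dif_neg fun h' => h h'.symm]

/-- Problematic only at the missing side, where the two gates might still be adjacent through the
side running back from `i + 1` to `i`. The hypothesis rules this out. -/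
theorem edgeWeight_gate_succ (μ : f.Branch → ℝ) (v : G.Vertex) (i : ZMod (P.k v))
    (h : ¬ (P.complete v ∨ i + 1 ≠ 0) → i ≠ i + 1 + 1 ∨ i = 0) :
    edgeWeight μ (P.gate v i).1 (P.gate v (i + 1)).1 = P.sideWeight μ v i := by
  rw [sideWeight]
  split_ifs with hc
  · rfl
  · rw [edgeWeight, dif_neg]
    rw [P.adj_iff]
    push Not at hc
    rintro (⟨-, h1 | h1⟩ | ⟨h1, h2 | h2⟩)
    · exact hc.1 h1
    · exact h1 hc.2
    · exact hc.1 h2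
    · rcases h (by push Not; exact hc) with h3 | h3
      · exact h3 h1
      · exact h2 h3

open scoped Classical in
theorem edgeWeight_gate (μ : f.Branch → ℝ) (hμ : ∀ b, μ (f.branchRev b) = μ b) (v : G.Vertex)
    (i j : ZMod (P.k v)) :
    edgeWeight μ (P.gate v i).1 (P.gate v j).1 =
      (if j = i + 1 then P.sideWeight μ v i else 0) +
        (if i = j + 1 then P.sideWeight μ v j else 0) := by
  by_cases h1 : j = i + 1 <;> by_cases h2 : i = j + 1
  · rw [if_pos h1, if_pos h2]
    -- At most two gates, hence a partial vertex. With one gate all terms vanish; with two, exactly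
    -- one of the two summands is the missing side.
    obtain ⟨hk, h0⟩ := zmod_eq_zero_or_of_two_step h1 h2
    have hc : ¬ P.complete v := fun h => by have := P.three_le v h; omega
    rw [sideWeight, sideWeight, ← h1, ← h2, edgeWeight_comm μ hμ (P.gate v j).1]
    by_cases hi : i = 0 <;> by_cases hj : j = 0
    · simp [hi, hj, hc, edgeWeight]
    · simp [hi, hj, hc]
    · simp [hi, hj, hc]
    · exact absurd h0 (by tauto)
  · rw [if_pos h1, if_neg h2, add_zero]
    subst h1
    exact P.edgeWeight_gate_succ μ v i fun _ => .inl h2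
  · rw [if_neg h1, if_pos h2, zero_add, edgeWeight_comm μ hμ]
    subst h2
    exact P.edgeWeight_gate_succ μ v j fun _ => .inl h1
  · rw [if_neg h1, if_neg h2, edgeWeight, dif_neg, add_zero]
    rw [P.adj_iff]
    tauto

theorem polygonSide_injective (v : G.Vertex) (hv : P.complete v) :
    Function.Injective (P.polygonSide v hv) := fun _ _ h =>
  (P.gate v).injective (Subtype.ext (congrArg (fun a => a.toProd.1) h))

/-- A coincidence would need at most two gates, but a complete polygon has at least three sides. -/
theorem polygonSide_ne_symm (v : G.Vertex) (hv : P.complete v) (i j : ZMod (P.k v)) :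
    P.polygonSide v hv i ≠ (P.polygonSide v hv j).symm := by
  intro h
  have h1 : i = j + 1 :=
    (P.gate v).injective (Subtype.ext (congrArg (fun a => a.toProd.1) h))
  have h2 : i + 1 = j :=
    (P.gate v).injective (Subtype.ext (congrArg (fun a => a.toProd.2) h))
  have h3 := (zmod_eq_zero_or_of_two_step h2.symm h1).1
  have h4 := P.three_le v hv
  omega

theorem exists_polygonSide (v : G.Vertex) (hv : P.complete v) (a : f.infinitesimal.Dart)
    (ha : f.gateVertex a.fst = v) :
    ∃ i, a = P.polygonSide v hv i ∨ a = (P.polygonSide v hv i).symm := by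
  obtain ⟨i, hi⟩ := P.exists_gate_eq v a.fst ha
  obtain ⟨j, hj⟩ := P.exists_gate_eq v a.snd ((gateVertex_eq_of_adj a.adj).symm.trans ha)
  have h := a.adj
  change f.infinitesimal.Adj a.fst a.snd at h
  rw [hi, hj, P.adj_iff] at h
  rcases h with ⟨rfl, -⟩ | ⟨rfl, -⟩
  · exact ⟨i, .inl (SimpleGraph.Dart.ext _ _ (Prod.ext hi hj))⟩
  · exact ⟨j, .inr (SimpleGraph.Dart.ext _ _ (Prod.ext hi hj))⟩

end Polygon

/-! ### Transverse measures and anti-invariant classes. -/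

section Covering

variable [Fintype D] (P : f.InfinitesimalPolygons)

open scoped Classical in
theorem pushWeight_mem_Wτ (z : P.orientationCover.cycles) : pushWeight z.1 ∈ f.Wτ := by
  obtain ⟨z, hz⟩ := z
  have h0 : ∀ b s, z (f.branchRev b, s + 1) = -z (b, s) := fun b s => hz.1 (b, s)
  have h2 : (1 + 1 : ZMod 2) = 0 := by decide
  constructor
  · rintro (d | a)
    · have h3 := h0 (.inl d) 0
      have h4 := h0 (.inl d) 1
      rw [zero_add] at h3
      rw [h2] at h4
      change z (f.branchRev (.inl d), 1) - z (f.branchRev (.inl d), 0) =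
        z (.inl d, 1) - z (.inl d, 0)
      rw [h3, h4]
      ring
    · have h3 := h0 (.inr a) 0
      have h4 := h0 (.inr a) 1
      rw [zero_add] at h3
      rw [h2] at h4
      change z (f.branchRev (.inr a), 0) - z (f.branchRev (.inr a), 1) =
        z (.inr a, 0) - z (.inr a, 1)
      rw [h3, h4]
      ring
  · intro γ
    have h3 : ∀ s : ZMod 2, (∑ d : D, if f.gateOf d = γ then z (.inl d, s) else 0) +
        (∑ a : f.infinitesimal.Dart, if a.fst = γ then z (.inr a, s) else 0) = 0 := by
      intro s
      have h4 : (∑ a : f.Branch × ZMod 2,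
          if (f.branchSrc a.1, a.2) = (γ, s) then z a else 0) = 0 := by
        refine Eq.trans (Finset.sum_congr rfl fun a _ => ?_)
          (P.orientationCover.sum_src_eq_zero z hz (γ, s))
        exact if_congr Iff.rfl rfl rfl
      have h5 : (∑ b : f.Branch, if f.branchSrc b = γ then z (b, s) else 0) = 0 := by
        refine Eq.trans ?_ h4
        rw [Fintype.sum_prod_type]
        refine Finset.sum_congr rfl fun b _ => ?_
        rw [Finset.sum_eq_single s]
        · exact if_congr (by simp) rfl rfl
        · intro t _ ht
          exact if_neg fun h => ht (congrArg Prod.snd h)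
        · simp
      rw [Fintype.sum_sum_type] at h5
      exact h5
    -- The cycle conditions at the two lifts of `γ`, subtracted, are the switch condition at `γ`:
    -- the opposite signs in `pushWeight` move the infinitesimal terms to the other side.
    have h4 := congrArg₂ (· - ·) (h3 1) (h3 0)
    simp only [← Finset.sum_filter] at h4 ⊢
    simp only [pushWeight, Finset.sum_sub_distrib]
    linarith

/-- The class of the lift of a transverse measure, as a linear map to `E⁻`. -/
noncomputable def liftMeasureClass : f.Wτ →ₗ[ℝ] P.Eminus where
  toFun μ := ⟨P.orientationCover.homologyClass (P.liftMeasure μ), by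
    rw [mem_Eminus_iff, deckOnH1_homologyClass, ← map_neg]
    exact congrArg _ (Subtype.ext (funext fun a =>
      (P.deck_onChains_apply _ a).trans (liftWeight_sheet μ.1 a)))⟩
  map_add' μ ν := by
    suffices h : P.liftMeasure (μ + ν) = P.liftMeasure μ + P.liftMeasure ν by
      exact Subtype.ext ((congrArg _ h).trans
        (map_add P.orientationCover.homologyClass (P.liftMeasure μ) (P.liftMeasure ν)))
    refine Subtype.ext (funext fun a => ?_)
    change liftWeight (μ.1 + ν.1) a = liftWeight μ.1 a + liftWeight ν.1 a
    simp only [liftWeight, Pi.add_apply]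
    split_ifs <;> ring
  map_smul' r μ := by
    suffices h : P.liftMeasure (r • μ) = r • P.liftMeasure μ by
      exact Subtype.ext ((congrArg _ h).trans
        (map_smul P.orientationCover.homologyClass r (P.liftMeasure μ)))
    refine Subtype.ext (funext fun a => ?_)
    change liftWeight (r • μ.1) a = r * liftWeight μ.1 a
    simp only [liftWeight, Pi.smul_apply, smul_eq_mul]
    split_ifs <;> ring

/-- Averaging with a sign: `(z - ι z)/2` is the lift of a weight in `W(τ)` and represents the class
of `z` when that class is anti-invariant. -/
theorem liftMeasureClass_surjective : Function.Surjective P.liftMeasureClass := by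
  rintro ⟨x, hx⟩
  rw [mem_Eminus_iff] at hx
  obtain ⟨z, rfl⟩ := P.orientationCover.homologyClass_surjective x
  refine ⟨(1 / 2 : ℝ) • ⟨pushWeight z.1, P.pushWeight_mem_Wτ z⟩, ?_⟩
  rw [map_smul]
  refine Subtype.ext ?_
  have h : P.liftMeasure ⟨pushWeight z.1, P.pushWeight_mem_Wτ z⟩ = z - P.deck.onCycles z := by
    refine Subtype.ext (funext fun a => ?_)
    exact (liftWeight_pushWeight z.1 a).trans
      (congrArg (z.1 a - ·) (P.deck_onChains_apply z.1 a).symm)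
  change (1 / 2 : ℝ) • P.orientationCover.homologyClass (P.liftMeasure
    ⟨pushWeight z.1, P.pushWeight_mem_Wτ z⟩) = P.orientationCover.homologyClass z
  rw [h, map_sub, ← deckOnH1_homologyClass, hx]
  module

/-- All 2-cells are attached along infinitesimal edges. -/
theorem boundaries_apply_inl (c : f.Branch × ZMod 2 → ℝ) (hc : c ∈ P.orientationCover.boundaries)
    (d : D) (s : ZMod 2) : c (.inl d, s) = 0 := by
  classical
  have : P.orientationCover.boundaries ≤
      LinearMap.ker (LinearMap.proj (R := ℝ) (φ := fun _ : P.orientationCover.Arc => ℝ)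
        (.inl d, s)) := by
    refine Submodule.span_le.2 ?_
    rintro _ ⟨F, rfl⟩
    refine LinearMap.mem_ker.2 ?_
    change P.orientationCover.faceBoundary F (.inl d, s) = 0
    rw [orientationCover_faceBoundary, Finset.sum_apply]
    refine Finset.sum_eq_zero fun i _ => ?_
    simp [coverSideChain, arcChain, coverRev, branchRev]
  exact this hc

/-! ### Weights vanishing on the real edges. -/

open scoped Classical in
theorem sum_dart_eq_sum_gate (μ : f.Branch → ℝ) (v : G.Vertex) [NeZero (P.k v)]
    (i : ZMod (P.k v)) :
    (∑ a : f.infinitesimal.Dart, if a.fst = (P.gate v i).1 then μ (.inr a) else 0) =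
      ∑ j, edgeWeight μ (P.gate v i).1 (P.gate v j).1 := by
  have h : (∑ j, edgeWeight μ (P.gate v i).1 (P.gate v j).1) =
      ∑ j with f.infinitesimal.Adj (P.gate v i).1 (P.gate v j).1,
        edgeWeight μ (P.gate v i).1 (P.gate v j).1 := by
    rw [Finset.sum_filter]
    refine Finset.sum_congr rfl fun j _ => ?_
    split_ifs with hj
    · rfl
    · exact dif_neg hj
  rw [h, ← Finset.sum_filter]
  symm
  refine Finset.sum_bij
    (fun j hj => ⟨((P.gate v i).1, (P.gate v j).1), (Finset.mem_filter.1 hj).2⟩) ?_ ?_ ?_ ?_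
  · intro j hj
    simp
  · intro j _ j' _ h
    have h' := congrArg (fun a => a.toProd.2) h
    exact (P.gate v).injective (Subtype.ext h')
  · intro a ha
    have ha' := (Finset.mem_filter.1 ha).2
    obtain ⟨j, hj⟩ := P.exists_gate_eq v a.snd
      ((gateVertex_eq_of_adj a.adj).symm.trans (by rw [ha']; exact (P.gate v i).2))
    refine ⟨j, Finset.mem_filter.2 ⟨Finset.mem_univ _, ?_⟩, ?_⟩
    · rw [← ha', ← hj]
      exact a.adj
    · exact SimpleGraph.Dart.ext _ _ (Prod.ext ha'.symm hj.symm)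
  · intro j hj
    exact dif_pos (Finset.mem_filter.1 hj).2

/-- Only the sides `i` and `i - 1` meet gate `i`, so with no real weight the switch condition makes
them cancel. -/
theorem sideWeight_add_sideWeight_pred (μ : f.Branch → ℝ) (hμ : μ ∈ f.Wτ)
    (h0 : ∀ d, μ (.inl d) = 0) (v : G.Vertex) (i : ZMod (P.k v)) :
    P.sideWeight μ v i + P.sideWeight μ v (i - 1) = 0 := by
  classical
  have : NeZero (P.k v) := ⟨(P.k_pos v).ne'⟩
  have h1 := hμ.2 (P.gate v i).1
  simp only [h0, ite_self, Finset.sum_const_zero] at h1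
  have h2 := (P.sum_dart_eq_sum_gate μ v i).symm.trans (Eq.trans (Finset.sum_congr rfl
    fun a _ => by congr) h1.symm)
  have h3 : ∀ j, (i = j + 1) = (j = i - 1) := fun j =>
    propext ⟨fun h => by rw [h, add_sub_cancel_right], fun h => by rw [h, sub_add_cancel]⟩
  simp only [P.edgeWeight_gate μ hμ.1, Finset.sum_add_distrib, h3, Finset.sum_ite_eq',
    Finset.mem_univ, if_true] at h2
  exact h2

theorem sideWeight_natCast (μ : f.Branch → ℝ) (hμ : μ ∈ f.Wτ)
    (h0 : ∀ d, μ (.inl d) = 0) (v : G.Vertex) (n : ℕ) :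
    P.sideWeight μ v (n : ZMod (P.k v)) = (-1) ^ n * P.sideWeight μ v 0 := by
  induction n with
  | zero => simp
  | succ n ih =>
    have h := P.sideWeight_add_sideWeight_pred μ hμ h0 v ((n + 1 : ℕ) : ZMod (P.k v))
    rw [Nat.cast_add, Nat.cast_one, add_sub_cancel_right, ih] at h
    rw [Nat.cast_add, Nat.cast_one, pow_succ]
    linarith

theorem sideWeight_eq_zero (μ : f.Branch → ℝ) (hμ : μ ∈ f.Wτ)
    (h0 : ∀ d, μ (.inl d) = 0) (v : G.Vertex) (hv : ¬ (P.complete v ∧ Even (P.k v)))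
    (i : ZMod (P.k v)) : P.sideWeight μ v i = 0 := by
  have : NeZero (P.k v) := ⟨(P.k_pos v).ne'⟩
  have hzero : P.sideWeight μ v 0 = 0 := by
    by_cases hc : P.complete v
    · have hk : Odd (P.k v) := Nat.not_even_iff_odd.1 fun h => hv ⟨hc, h⟩
      -- Once around an odd polygon the weight returns with the opposite sign.
      have h := P.sideWeight_natCast μ hμ h0 v (P.k v)
      rw [ZMod.natCast_self, hk.neg_one_pow] at h
      linarith
    -- Side `k - 1` ends at gate `0`, so it is the missing side and has weight `0`; up to sign it
    -- equals side `0`.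
    · have h := P.sideWeight_natCast μ hμ h0 v (P.k v - 1)
      have h1 : ((P.k v - 1 : ℕ) : ZMod (P.k v)) + 1 = 0 := by
        rw [← Nat.cast_add_one, Nat.sub_add_cancel (P.k_pos v), ZMod.natCast_self]
      rw [sideWeight, if_neg (by simp [hc, h1])] at h
      exact (mul_eq_zero.1 h.symm).resolve_left (pow_ne_zero _ (by norm_num))
  rw [← ZMod.natCast_zmod_val i, P.sideWeight_natCast μ hμ h0, hzero, mul_zero]

open scoped Classical in
/-- The part of a 1-chain of `S̃` formed by the oriented edges that start over `v`. -/
noncomputable def restrictVertex (v : G.Vertex) (c : f.Branch × ZMod 2 → ℝ) :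
    f.Branch × ZMod 2 → ℝ :=
  fun a => if f.gateVertex (f.branchSrc a.1) = v then c a else 0

/-- Both ends of an infinitesimal edge lie at one vertex, so restricting respects reversal. A real
edge may join different vertices, hence the vanishing assumption. -/
theorem restrictVertex_mem_chains (v : G.Vertex) (c : f.Branch × ZMod 2 → ℝ)
    (hc : c ∈ P.orientationCover.chains) (h0 : ∀ d s, c (.inl d, s) = 0) :
    restrictVertex v c ∈ P.orientationCover.chains := by
  rintro ⟨d | a, s⟩
  · change restrictVertex v c (.inl (G.rev d), s + 1) = -restrictVertex v c (.inl d, s)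
    simp [restrictVertex, h0]
  · have h1 : c (.inr a.symm, s + 1) = -c (.inr a, s) := hc (.inr a, s)
    have h2 : f.gateVertex a.symm.fst = f.gateVertex a.fst :=
      (gateVertex_eq_of_adj a.adj).symm
    change restrictVertex v c (.inr a.symm, s + 1) = -restrictVertex v c (.inr a, s)
    by_cases hv : f.gateVertex a.fst = v
    · exact (if_pos (h2.trans hv)).trans (h1.trans (congrArg Neg.neg (if_pos hv).symm))
    · have h3 : restrictVertex v c (.inr a, s) = 0 := if_neg hv
      rw [h3, neg_zero]
      exact if_neg fun h => hv (h2.symm.trans h)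

theorem restrictVertex_eq_zero (μ : f.Branch → ℝ) (hμ : μ ∈ f.Wτ)
    (h0 : ∀ d, μ (.inl d) = 0) (v : G.Vertex) (hv : ¬ (P.complete v ∧ Even (P.k v))) :
    restrictVertex v (liftWeight μ) = 0 := by
  classical
  funext ⟨b, s⟩
  rw [restrictVertex]
  split_ifs with hb
  · have hμb : μ b = 0 := by
      rcases b with d | a
      · exact h0 d
      · obtain ⟨i, hi⟩ := P.exists_gate_eq v a.fst hb
        obtain ⟨j, hj⟩ := P.exists_gate_eq v a.snd ((gateVertex_eq_of_adj a.adj).symm.trans hb)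
        rw [← edgeWeight_dart μ a, hi, hj, P.edgeWeight_gate μ hμ.1,
          P.sideWeight_eq_zero μ hμ h0 v hv, P.sideWeight_eq_zero μ hμ h0 v hv]
        simp
    simp [liftWeight, hμb]
  · rfl

theorem restrictVertex_eq_sum (v : G.Vertex) (hv : P.complete v) (c : f.Branch × ZMod 2 → ℝ)
    (hc : c ∈ P.orientationCover.chains) (h0 : ∀ d s, c (.inl d, s) = 0) :
    restrictVertex v c = ∑ i ∈ Finset.range (P.k v),
      (c (.inr (P.polygonSide v hv i), 0) • P.coverSideChain v hv i 0 +
        c (.inr (P.polygonSide v hv i), 1) • P.coverSideChain v hv i 1) := by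
  classical
  have : NeZero (P.k v) := ⟨(P.k_pos v).ne'⟩
  have h := P.orientationCover.eq_sum_arcChain
    (Finset.range (P.k v) ×ˢ (Finset.univ : Finset (ZMod 2)))
    (fun p => (.inr (P.polygonSide v hv (p.1 : ZMod (P.k v))), p.2)) (restrictVertex v c)
    (P.restrictVertex_mem_chains v c hc h0) ?_ ?_ ?_
  · refine h.trans ((Finset.sum_product _ _ _).trans (Finset.sum_congr rfl fun i _ => ?_))
    have hr : ∀ s : ZMod 2, restrictVertex v c (.inr (P.polygonSide v hv i), s) =
        c (.inr (P.polygonSide v hv i), s) := fun s => if_pos (P.gate v i).2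
    refine (Fin.sum_univ_two _).trans ?_
    exact congrArg₂ (fun x y : ℝ => x • P.coverSideChain v hv i 0 + y • P.coverSideChain v hv i 1)
      (hr 0) (hr 1)
  · rintro ⟨i, s⟩ hi ⟨j, t⟩ hj h
    simp only [Finset.coe_product, Set.mem_prod, Finset.coe_range, Set.mem_Iio] at hi hj
    have h1 := P.polygonSide_injective v hv (Sum.inr_injective (congrArg Prod.fst h))
    rw [ZMod.natCast_eq_natCast_iff] at h1
    exact Prod.ext (Nat.ModEq.eq_of_lt_of_lt h1 hi.1 hj.1) (congrArg (fun a : f.Branch × ZMod 2 => a.2) h)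
  · rintro p - q - h
    exact P.polygonSide_ne_symm v hv _ _ (Sum.inr_injective (congrArg Prod.fst h))
  · rintro ⟨d | a, s⟩ hb
    · exact absurd (by simp [restrictVertex, h0]) hb
    · have ha : f.gateVertex a.fst = v := by
        by_contra ha
        exact hb (if_neg ha)
      obtain ⟨i, hi⟩ := P.exists_polygonSide v hv a ha
      rcases hi with rfl | rfl
      · refine ⟨(i.val, s), by simp [ZMod.val_lt], .inl ?_⟩
        change _ = (Sum.inr (P.polygonSide v hv ((i.val : ℕ) : ZMod (P.k v))), s)
        rw [ZMod.natCast_zmod_val]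
      -- Reversal changes the sheet: a reversed side on sheet `s` is the reverse of the lift on
      -- sheet `s + 1`.
      · refine ⟨(i.val, s + 1), by simp [ZMod.val_lt], .inr ?_⟩
        change _ = (Sum.inr (P.polygonSide v hv ((i.val : ℕ) : ZMod (P.k v))).symm, s + 1 + 1)
        rw [ZMod.natCast_zmod_val, zmod_two_add_one_add_one]

/-- At an even complete vertex, side `i` has weight `(-1)^i w`, and its lifts on sheets `0` and `1`
get this coefficient with signs `+` and `-`. The disc starting on sheet `s` runs along side `i` on
sheet `s + i`, so the difference of the two disc boundaries shows the same alternation. -/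
theorem restrictVertex_liftWeight_mem_boundaries (μ : f.Branch → ℝ) (hμ : μ ∈ f.Wτ)
    (h0 : ∀ d, μ (.inl d) = 0) (v : G.Vertex) :
    restrictVertex v (liftWeight μ) ∈ P.orientationCover.boundaries := by
  by_cases hv : P.complete v ∧ Even (P.k v)
  swap
  · rw [P.restrictVertex_eq_zero μ hμ h0 v hv]
    exact zero_mem _
  obtain ⟨hv, hk⟩ := hv
  have hb := P.sum_coverSideChain_mem_of_not_odd v hv (Nat.not_odd_iff_even.2 hk)
  have hmem := P.orientationCover.boundaries.smul_mem (P.sideWeight μ v 0)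
    (sub_mem (hb 0) (hb 1))
  refine (congrArg (· ∈ P.orientationCover.boundaries) ?_).mpr hmem
  have h0' : ∀ (d : D) (s : ZMod 2), liftWeight μ (.inl d, s) = 0 := fun d s => by
    simp [liftWeight, h0]
  refine (P.restrictVertex_eq_sum v hv _ (P.liftWeight_mem_cycles μ hμ).1 h0').trans ?_
  refine Eq.trans ?_ (congrArg _ (Finset.sum_sub_distrib _ _))
  refine Eq.trans (Finset.sum_congr rfl fun i _ => ?_) Finset.smul_sum.symm
  have hside : μ (.inr (P.polygonSide v hv i)) = (-1) ^ i * P.sideWeight μ v 0 := by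
    rw [← P.sideWeight_natCast μ hμ h0, sideWeight, if_pos (.inl hv),
      ← edgeWeight_dart μ]
    rfl
  rw [liftWeight_inr, liftWeight_inr_one, hside]
  have h2 : (1 + 1 : ZMod 2) = 0 := by decide
  have h3 : ∀ (m : ℝ) (x y : f.Branch × ZMod 2 → ℝ),
      (1 * m) • x + (-(1 * m)) • y = m • (x - y) := fun m x y => by module
  have h4 : ∀ (m : ℝ) (x y : f.Branch × ZMod 2 → ℝ),
      (-1 * m) • x + (-(-1 * m)) • y = m • (y - x) := fun m x y => by module
  rcases Nat.even_or_odd i with hi | hi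
  · rw [hi.neg_one_pow, (ZMod.natCast_eq_zero_iff_even).2 hi, add_zero, add_zero]
    exact h3 _ _ _
  · rw [hi.neg_one_pow, (ZMod.natCast_eq_one_iff_odd).2 hi, h2, zero_add]
    exact h4 _ _ _

theorem liftWeight_mem_boundaries_iff (μ : f.Branch → ℝ) (hμ : μ ∈ f.Wτ) :
    liftWeight μ ∈ P.orientationCover.boundaries ↔ ∀ d, μ (.inl d) = 0 := by
  classical
  refine ⟨fun h d => ?_, fun h0 => ?_⟩
  · rw [← liftWeight_inl μ d]
    exact P.boundaries_apply_inl _ h d 1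
  · have : Finite G.Vertex := Quotient.finite _
    have : Fintype G.Vertex := Fintype.ofFinite _
    -- Every oriented branch starts at exactly one vertex, so the lift splits into its vertex parts,
    -- each of which bounds.
    have h : liftWeight μ = ∑ v : G.Vertex, restrictVertex v (liftWeight μ) := by
      funext a
      rw [Finset.sum_apply]
      simp [restrictVertex]
    rw [h]
    exact Submodule.sum_mem P.orientationCover.boundaries fun v _ =>
      P.restrictVertex_liftWeight_mem_boundaries μ hμ h0 v

theorem ker_collapseW_eq_ker_liftMeasureClass :
    LinearMap.ker f.collapseW = LinearMap.ker P.liftMeasureClass := by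
  ext μ
  have h1 : P.liftMeasureClass μ = 0 ↔ liftWeight μ.1 ∈ P.orientationCover.boundaries :=
    Subtype.ext_iff.trans (P.orientationCover.homologyClass_eq_zero_iff (P.liftMeasure μ))
  have h2 : f.collapseW μ = 0 ↔ ∀ d, μ.1 (.inl d) = 0 := Subtype.ext_iff.trans funext_iff
  rw [LinearMap.mem_ker, LinearMap.mem_ker, h1, h2, P.liftWeight_mem_boundaries_iff μ.1 μ.2]

end Covering

end InfinitesimalPolygons

theorem collapseW_surjective [Fintype D] : Function.Surjective f.collapseW := by
  rintro ⟨_, μ, hμ, rfl⟩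
  exact ⟨⟨μ, hμ⟩, rfl⟩

end TrainTrackMap

/-! ### The decomposition theorem. -/

theorem mainTheorem3 {D : Type*} [Fintype D] {G : RibbonGraph D} (f : TrainTrackMap G)
    (P : f.InfinitesimalPolygons) (hτ : ¬ f.Orientable) :
    IsCompl P.Eplus P.Eminus ∧
    (∃ Ψ : P.surface.H1 ≃ₗ[ℝ] P.Eplus, ∀ c : P.surface.cycles,
      (Ψ (P.surface.homologyClass c) : P.orientationCover.H1) =
        P.orientationCover.homologyClass (P.liftCycle c)) ∧
    (∃ Φ : f.W ≃ₗ[ℝ] P.Eminus, ∀ μ : f.Wτ,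
      (Φ (f.collapseW μ) : P.orientationCover.H1) =
        P.orientationCover.homologyClass (P.liftMeasure μ)) := by
  refine ⟨isCompl_eigenspace_of_involutive P.deckOnH1 P.deckOnH1_deckOnH1, ?_, ?_⟩
  · obtain ⟨Ψ, hΨ⟩ := exists_linearEquiv_of_ker_eq P.surface.homologyClass P.liftCycleClass
      P.surface.homologyClass_surjective P.liftCycleClass_surjective
      P.ker_homologyClass_eq_ker_liftCycleClass
    exact ⟨Ψ, fun c => congrArg Subtype.val (hΨ c)⟩
  · obtain ⟨Φ, hΦ⟩ := exists_linearEquiv_of_ker_eq f.collapseW P.liftMeasureClass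
      TrainTrackMap.collapseW_surjective P.liftMeasureClass_surjective
      P.ker_collapseW_eq_ker_liftMeasureClass
    exact ⟨Φ, fun μ => congrArg Subtype.val (hΦ μ)⟩
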